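/- Let $a, c \in \mathbb{C}$ and let $f, g : \mathbb{C} \to \mathbb{C}$ be the linear maps $f(z) = az$, $g(z) = cz$. Then $f$ and $g$ are topologically conjugate, i.e. there exists a homeomorphism $h : \mathbb{C} \to \mathbb{C}$ such that $g = h \circ f \circ h^{-1}$, if and only if at least one of the following holds: 1. $0 < |a| < 1$ and $0 < |c| < 1$; 2. $|a| > 1$ and $|c| > 1$; 3. $a = c$; 4. $a = \bar{c}$. -/

import Mathlib

/-- Two self-maps `f, g` of a topological space are topologically conjugate if
`g = h ∘ f ∘ h⁻¹` for some self-homeomorphism `h` of the space. -/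
def TopologicallyConjugate {X : Type*} [TopologicalSpace X] (f g : X → X) : Prop :=
  ∃ h : X ≃ₜ X, g = h ∘ f ∘ h.symm

open Complex Filter Topology

namespace TopologicallyConjugate

/-! Conjugacy preserves convergence of orbits to the fixed point 0, which separates |a| < 1, |a| > 1
(pass to inverses) and |a| = 1; the multipliers 0 and 1 are settled directly. For rotations, lift
`h` through `exp`: the lift has degree ±1, and comparing how it responds to the shifts 2πi and iθ
forces c = a or c = a⁻¹, where a⁻¹ is the conjugate of a. Conversely, contractions are conjugated by
a multiplicative spiral map sending a to c, and expansions reduce to contractions by inversion. -/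

theorem symm {X : Type*} [TopologicalSpace X] {f g : X → X}
    (hfg : TopologicallyConjugate f g) : TopologicallyConjugate g f := by
  obtain ⟨h, rfl⟩ := hfg
  exact ⟨h.symm, by ext x; simp⟩

end TopologicallyConjugate

theorem topologicallyConjugate_iff_semiconj {X : Type*} [TopologicalSpace X] {f g : X → X} :
    TopologicallyConjugate f g ↔ ∃ h : X ≃ₜ X, Function.Semiconj h f g := by
  refine exists_congr fun h => ⟨?_, fun hs => ?_⟩
  · rintro rfl x
    simp
  · ext x
    simp [hs (h.symm x)]

theorem topologicallyConjugate_mul_iff {a c : ℂ} :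
    TopologicallyConjugate (fun z : ℂ => a * z) (fun z : ℂ => c * z) ↔
      ∃ h : ℂ ≃ₜ ℂ, ∀ z, h (a * z) = c * h z :=
  topologicallyConjugate_iff_semiconj

namespace TopologicallyConjugate

variable {a c : ℂ}

theorem mul_eq_zero
    (H : TopologicallyConjugate (fun z : ℂ => a * z) (fun z : ℂ => c * z)) (ha : a = 0) :
    c = 0 := by
  obtain ⟨h, hh⟩ := topologicallyConjugate_mul_iff.1 H
  have h0 := hh (h.symm 0)
  have h1 := hh (h.symm 1)
  simp only [ha, zero_mul, h.apply_symm_apply, mul_zero, mul_one] at h0 h1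
  exact h1.symm.trans h0

theorem mul_eq_one
    (H : TopologicallyConjugate (fun z : ℂ => a * z) (fun z : ℂ => c * z)) (ha : a = 1) :
    c = 1 := by
  obtain ⟨h, hh⟩ := topologicallyConjugate_mul_iff.1 H
  have h1 := hh (h.symm 1)
  simp only [ha, one_mul, h.apply_symm_apply, mul_one] at h1
  exact h1.symm

theorem mul_inv (hac : TopologicallyConjugate (fun z : ℂ => a * z) (fun z : ℂ => c * z))
    (ha : a ≠ 0) (hc : c ≠ 0) :
    TopologicallyConjugate (fun z : ℂ => a⁻¹ * z) (fun z : ℂ => c⁻¹ * z) := by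
  obtain ⟨h, hh⟩ := topologicallyConjugate_mul_iff.1 hac
  refine topologicallyConjugate_mul_iff.2 ⟨h, fun z => ?_⟩
  rw [eq_inv_mul_iff_mul_eq₀ hc, ← hh, mul_inv_cancel_left₀ ha]

end TopologicallyConjugate

/-- A homeomorphism conjugating nontrivial linear maps fixes the origin. -/
theorem Homeomorph.apply_zero_of_semiconj_mul {a c : ℂ} {h : ℂ ≃ₜ ℂ}
    (hh : ∀ z, h (a * z) = c * h z) (ha : a ≠ 1) : h 0 = 0 := by
  have hc : c ≠ 1 := fun hc =>
    ha ((topologicallyConjugate_mul_iff.2 ⟨h, hh⟩).symm.mul_eq_one hc)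
  have h0 := hh 0
  rw [mul_zero] at h0
  have : (c - 1) * h 0 = 0 := by linear_combination -h0
  exact (_root_.mul_eq_zero.1 this).resolve_left (sub_ne_zero.2 hc)

namespace TopologicallyConjugate

variable {a c : ℂ}

/-- The `f`-orbit of `h.symm 1` tends to 0, and `h` carries it to the powers of c, so c ^ n → h 0 =
0. -/
theorem norm_lt_one
    (H : TopologicallyConjugate (fun z : ℂ => a * z) (fun z : ℂ => c * z)) (ha : ‖a‖ < 1) :
    ‖c‖ < 1 := by
  obtain ⟨h, hh⟩ := topologicallyConjugate_mul_iff.1 H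
  have h0 : h 0 = 0 := Homeomorph.apply_zero_of_semiconj_mul hh (by rintro rfl; simp at ha)
  have hpow (n : ℕ) : h (a ^ n * h.symm 1) = c ^ n := by
    induction n with
    | zero => simp
    | succ n ih => rw [pow_succ', mul_assoc, hh, ih, pow_succ']
  have ht : Tendsto (fun n : ℕ => a ^ n * h.symm 1) atTop (𝓝 0) := by
    simpa using (tendsto_pow_atTop_nhds_zero_of_norm_lt_one ha).mul_const (h.symm 1)
  have := (h.continuous.tendsto 0).comp ht
  simp only [Function.comp_def, hpow, h0] at this
  exact tendsto_pow_atTop_nhds_zero_iff_norm_lt_one.1 this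

theorem one_lt_norm
    (H : TopologicallyConjugate (fun z : ℂ => a * z) (fun z : ℂ => c * z)) (ha : 1 < ‖a‖) :
    1 < ‖c‖ := by
  have ha0 : a ≠ 0 := norm_pos_iff.1 (one_pos.trans ha)
  have hc0 : c ≠ 0 := fun hc => ha0 (H.symm.mul_eq_zero hc)
  have := (H.mul_inv ha0 hc0).norm_lt_one (by rw [norm_inv]; exact inv_lt_one_of_one_lt₀ ha)
  rw [norm_inv] at this
  exact (inv_lt_one₀ (norm_pos_iff.2 hc0)).1 this

end TopologicallyConjugate

/-- Two continuous logarithms of the same function on a connected space differ by an integer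
multiple of `2πi`. -/
theorem Complex.exists_int_eq_add_of_exp_comp_eq {X : Type*} [TopologicalSpace X]
    [ConnectedSpace X] {F G : X → ℂ} (hF : Continuous F) (hG : Continuous G)
    (h : ∀ x, exp (F x) = exp (G x)) :
    ∃ n : ℤ, ∀ x, F x = G x + n * (2 * Real.pi * I) := by
  have hexp (x : X) : exp (F x - G x) = 1 := by rw [exp_sub, h, div_self (exp_ne_zero _)]
  obtain ⟨x₀⟩ := (inferInstance : Nonempty X)
  obtain ⟨n, hn⟩ := exp_eq_one_iff.1 (hexp x₀)
  refine ⟨n, fun x => ?_⟩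
  -- The difference F - G lifts a constant through the covering `exp`, hence is constant.
  have := isCoveringMap_exp.const_of_comp (hF.sub hG)
    (fun x y => Subtype.ext ((hexp x).trans (hexp y).symm)) x x₀
  simp only [Pi.sub_apply] at this
  linear_combination this + hn

/-- A homeomorphism of the plane fixing the origin lifts through the exponential. -/
theorem Homeomorph.exists_continuous_exp_lift (h : ℂ ≃ₜ ℂ) (h0 : h 0 = 0) :
    ∃ H : ℂ → ℂ, Continuous H ∧ ∀ z, exp (H z) = h (exp z) := by
  have hne (z : ℂ) : h (exp z) ≠ 0 := fun hz =>
    exp_ne_zero z (h.injective (hz.trans h0.symm))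
  have hU : IsSimplyConnected (_root_.Set.univ : Set ℂ) := by
    have := (convex_univ (𝕜 := ℝ) (E := ℂ)).contractibleSpace _root_.Set.univ_nonempty
    exact SimplyConnectedSpace.ofContractible _
  obtain ⟨H, hH, hexp⟩ := exists_continuousOn_eqOn_exp_comp hU isOpen_univ
    (h.continuous.comp continuous_exp).continuousOn
    (by rintro ⟨z, -, hz⟩; exact hne z hz)
  exact ⟨H, continuousOn_univ.1 hH, fun z => hexp (_root_.Set.mem_univ z)⟩

/-- Every continuous lift of a homeomorphism of the punctured plane has degree `1` or `-1`. -/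
theorem Homeomorph.exists_isUnit_degree_of_exp_lift (h : ℂ ≃ₜ ℂ) (h0 : h 0 = 0) {H : ℂ → ℂ}
    (hH : Continuous H) (hexp : ∀ z, exp (H z) = h (exp z)) :
    ∃ d : ℤ, IsUnit d ∧
      ∀ z, H (z + 2 * Real.pi * I) = H z + d * (2 * Real.pi * I) := by
  have degree (k : ℂ ≃ₜ ℂ) {K : ℂ → ℂ} (hK : Continuous K)
      (hKexp : ∀ z, exp (K z) = k (exp z)) :
      ∃ e : ℤ, ∀ z, K (z + 2 * Real.pi * I) = K z + e * (2 * Real.pi * I) :=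
    exists_int_eq_add_of_exp_comp_eq (hK.comp (by fun_prop)) hK fun z => by
      simp only [hKexp, exp_add, exp_two_pi_mul_I, mul_one]
  obtain ⟨K, hK, hKexp⟩ := h.symm.exists_continuous_exp_lift (by rw [h.symm_apply_eq, h0])
  obtain ⟨d, hd⟩ := degree h hH hexp
  obtain ⟨e, he⟩ := degree h.symm hK hKexp
  -- K ∘ H lifts the identity, so it is a translation; comparing its values at 2πi and 0 gives d * e
  -- = 1.
  obtain ⟨m, hm⟩ := exists_int_eq_add_of_exp_comp_eq (hK.comp hH) continuous_id fun z => by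
    simp [hKexp, hexp]
  simp only [Function.comp_apply, id] at hm
  have hen (n : ℤ) (z : ℂ) : K (z + n * (2 * Real.pi * I)) = K z + n * (e * (2 * Real.pi * I)) := by
    have hper : Function.Periodic (fun w => K w - e * w) (2 * Real.pi * I) := fun w => by
      simp only [he]; ring
    have := hper.int_mul n z
    linear_combination this
  refine ⟨d, IsUnit.of_mul_eq_one e ?_, hd⟩
  have h1 := hm (2 * Real.pi * I)
  have h2 := hm 0
  have h3 := hd 0
  rw [zero_add] at h3
  rw [h3, hen] at h1
  have : ((d * e : ℤ) : ℂ) * (2 * Real.pi * I) = 1 * (2 * Real.pi * I) := by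
    push_cast
    linear_combination h1 - h2
  exact_mod_cast mul_right_cancel₀ two_pi_I_ne_zero this

/-- A continuous periodic function on `ℝ` admits no nonzero additive quasi-period. -/
theorem Function.Periodic.eq_zero_of_add_const {G : ℝ → ℂ} {p θ : ℝ} {κ : ℂ}
    (hG : Function.Periodic G p) (hp : p ≠ 0) (hc : Continuous G)
    (hθ : ∀ y, G (y + θ) = G y + κ) : κ = 0 := by
  obtain ⟨C, hC⟩ := (hG.isBounded_of_continuous hp hc).exists_norm_le
  have hn (n : ℕ) : G (n * θ) = G 0 + n * κ := by
    induction n with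
    | zero => simp
    | succ n ih => push_cast; rw [add_mul, one_mul, hθ, ih]; ring
  -- G is bounded, while G (n θ) - G 0 = n κ grows unless κ = 0.
  by_contra hκ
  obtain ⟨n, hlt⟩ := exists_nat_gt (2 * C / ‖κ‖)
  rw [div_lt_iff₀ (norm_pos_iff.2 hκ)] at hlt
  have h1 : ‖(n : ℂ) * κ‖ ≤ C + C := by
    rw [show (n : ℂ) * κ = G (n * θ) - G 0 by rw [hn]; ring]
    exact (norm_sub_le _ _).trans (add_le_add (hC _ ⟨_, rfl⟩) (hC _ ⟨_, rfl⟩))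
  rw [norm_mul, norm_natCast] at h1
  linarith

/-- Topologically conjugate rotations of the plane are equal or inverse to each other. -/
theorem TopologicallyConjugate.eq_or_eq_inv_of_norm_eq_one {a c : ℂ}
    (H : TopologicallyConjugate (fun z : ℂ => a * z) (fun z : ℂ => c * z)) (ha : ‖a‖ = 1)
    (hc : c ≠ 0) : c = a ∨ c = a⁻¹ := by
  by_cases ha1 : a = 1
  · exact Or.inl ((H.mul_eq_one ha1).trans ha1.symm)
  obtain ⟨h, hh⟩ := topologicallyConjugate_mul_iff.1 H
  have h0 := Homeomorph.apply_zero_of_semiconj_mul hh ha1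
  obtain ⟨F, hF, hexp⟩ := h.exists_continuous_exp_lift h0
  obtain ⟨d, hdu, hd⟩ := h.exists_isUnit_degree_of_exp_lift h0 hF hexp
  obtain ⟨θ, rfl⟩ := (norm_eq_one_iff a).1 ha
  obtain ⟨γ, rfl⟩ : ∃ γ, exp γ = c := ⟨log c, exp_log hc⟩
  obtain ⟨m, hm⟩ := exists_int_eq_add_of_exp_comp_eq (F := fun z => F (z + θ * I))
    (G := fun z => F z + γ) (by fun_prop) (by fun_prop) fun z => by
      rw [hexp, exp_add, mul_comm, hh, exp_add, hexp, mul_comm]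
  -- On the imaginary axis, subtracting the linear part of slope d leaves a 2π-periodic function;
  -- the shift by θ adds the constant κ to it, so κ = 0, i.e. γ ≡ d θ i mod 2πi.
  have hper : Function.Periodic (fun y : ℝ => F (y * I) - d * (y * I)) (2 * Real.pi) := fun y => by
    have := hd (y * I)
    push_cast
    rw [add_mul, this]
    ring
  have hκ := hper.eq_zero_of_add_const (θ := θ) (κ := γ + m * (2 * Real.pi * I) - d * (θ * I))
    Real.two_pi_pos.ne' (by fun_prop) fun y => by
      have := hm (y * I)
      push_cast
      rw [add_mul, this]
      ring
  have hγ : exp γ = exp (θ * I) ^ d := by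
    rw [← exp_int_mul, exp_eq_exp_iff_exists_int]
    exact ⟨-m, by push_cast; linear_combination hκ⟩
  rcases Int.isUnit_iff.1 hdu with rfl | rfl
  · exact Or.inl (by simpa using hγ)
  · exact Or.inr (by simpa using hγ)

/-- The spiral map `z ↦ z * exp (w * log ‖z‖)`. -/
noncomputable def spiral (w z : ℂ) : ℂ := z * exp (w * Real.log ‖z‖)

theorem norm_spiral (w z : ℂ) : ‖spiral w z‖ = ‖z‖ * Real.exp (w.re * Real.log ‖z‖) := by
  simp [spiral, norm_exp]

theorem log_norm_spiral (w : ℂ) {z : ℂ} (hz : z ≠ 0) :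
    Real.log ‖spiral w z‖ = (1 + w.re) * Real.log ‖z‖ := by
  rw [norm_spiral, Real.log_mul (norm_ne_zero_iff.2 hz) (Real.exp_ne_zero _), Real.log_exp]
  ring

/-- Only the origin is delicate: there ‖spiral w z‖ = ‖z‖ ^ (1 + w.re), with positive exponent. -/
theorem continuous_spiral {w : ℂ} (hw : 0 < 1 + w.re) : Continuous (spiral w) := by
  rw [continuous_iff_continuousAt]
  intro z
  by_cases hz : z = 0
  · subst hz
    have hnorm (z : ℂ) : ‖spiral w z‖ = ‖z‖ ^ (1 + w.re) := by
      by_cases hz : z = 0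
      · simp [hz, spiral, Real.zero_rpow hw.ne']
      · rw [norm_spiral, Real.rpow_add (norm_pos_iff.2 hz), Real.rpow_one,
          Real.rpow_def_of_pos (norm_pos_iff.2 hz), mul_comm w.re]
    have h0 : spiral w 0 = 0 := by simp [spiral]
    rw [ContinuousAt, h0, tendsto_zero_iff_norm_tendsto_zero]
    simp only [hnorm]
    have : ContinuousAt (fun z : ℂ => ‖z‖ ^ (1 + w.re)) 0 :=
      continuous_norm.continuousAt.rpow_const (Or.inr hw.le)
    simpa [ContinuousAt, Real.zero_rpow hw.ne'] using this
  · have hlog : ContinuousAt (fun z : ℂ => Real.log ‖z‖) z :=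
      continuous_norm.continuousAt.log (norm_ne_zero_iff.2 hz)
    have : ContinuousAt (fun z : ℂ => ((Real.log ‖z‖ : ℝ) : ℂ)) z :=
      continuous_ofReal.continuousAt.comp hlog
    exact continuousAt_id.mul (continuous_exp.continuousAt.comp (continuousAt_const.mul this))

theorem spiral_spiral {w w' : ℂ} (hw : w' * (1 + w.re) = -w) (z : ℂ) :
    spiral w' (spiral w z) = z := by
  by_cases hz : z = 0
  · simp [hz, spiral]
  · rw [spiral, log_norm_spiral w hz, spiral, mul_assoc, ← exp_add]
    push_cast
    rw [← mul_assoc w', hw]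
    simp

/-- Since log ‖·‖ turns products into sums, the spiral intertwines multiplication by a with
multiplication by `spiral w a`. -/
theorem spiral_mul (w : ℂ) {a z : ℂ} (ha : a ≠ 0) :
    spiral w (a * z) = spiral w a * spiral w z := by
  by_cases hz : z = 0
  · simp [hz, spiral]
  · simp only [spiral]
    rw [norm_mul, Real.log_mul (norm_ne_zero_iff.2 ha) (norm_ne_zero_iff.2 hz), ofReal_add,
      mul_add, exp_add]
    ring

/-- The spiral map as a homeomorphism of the plane. -/
noncomputable def spiralHomeomorph (w : ℂ) (hw : 0 < 1 + w.re) : ℂ ≃ₜ ℂ where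
  toFun := spiral w
  invFun := spiral (-w / ((1 + w.re : ℝ) : ℂ))
  left_inv := spiral_spiral (by
    rw [← ofReal_one, ← ofReal_add, div_mul_cancel₀ _ (ofReal_ne_zero.2 hw.ne')])
  right_inv := spiral_spiral (by
    rw [div_ofReal_re, neg_re, ← ofReal_one, ← ofReal_add]
    rw [show 1 + -w.re / (1 + w.re) = (1 + w.re)⁻¹ by field_simp; ring, ofReal_inv, neg_div, neg_neg,
      div_eq_mul_inv])
  continuous_toFun := continuous_spiral hw
  continuous_invFun := continuous_spiral (by
    rw [div_ofReal_re, neg_re, show 1 + -w.re / (1 + w.re) = (1 + w.re)⁻¹ by field_simp; ring]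
    exact inv_pos.2 hw)

theorem topologicallyConjugate_mul_of_norm_lt_one {a c : ℂ} (ha0 : 0 < ‖a‖) (ha1 : ‖a‖ < 1)
    (hc0 : 0 < ‖c‖) (hc1 : ‖c‖ < 1) :
    TopologicallyConjugate (fun z : ℂ => a * z) (fun z : ℂ => c * z) := by
  have hla := Real.log_neg ha0 ha1
  have hlc := Real.log_neg hc0 hc1
  have ha : a ≠ 0 := norm_pos_iff.1 ha0
  have hc : c ≠ 0 := norm_pos_iff.1 hc0
  -- Chosen so that spiral w a = a * exp (log c - log a) = c; then 1 + w.re = log ‖c‖ / log ‖a‖, a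
  -- quotient of two negatives.
  set w : ℂ := (log c - log a) / (Real.log ‖a‖ : ℝ) with hwdef
  have hw : 0 < 1 + w.re := by
    rw [hwdef, div_ofReal_re, sub_re, log_re, log_re, sub_div, div_self hla.ne,
      add_sub_cancel]
    exact div_pos_of_neg_of_neg hlc hla
  have hwa : spiral w a = c := by
    rw [spiral, hwdef, div_mul_cancel₀ _ (ofReal_ne_zero.2 hla.ne), exp_sub, exp_log hc,
      exp_log ha, mul_div_cancel₀ _ ha]
  refine topologicallyConjugate_mul_iff.2 ⟨spiralHomeomorph w hw, fun z => ?_⟩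
  exact (spiral_mul w ha).trans (by rw [hwa]; rfl)

theorem lemma4p1 (a c : ℂ) :
    TopologicallyConjugate (fun z : ℂ => a * z) (fun z : ℂ => c * z) ↔
      ((0 < ‖a‖ ∧ ‖a‖ < 1) ∧ (0 < ‖c‖ ∧ ‖c‖ < 1)) ∨
        (1 < ‖a‖ ∧ 1 < ‖c‖) ∨
        a = c ∨
        a = starRingEnd ℂ c := by
  constructor
  · intro H
    by_cases ha : a = 0
    · exact Or.inr (Or.inr (Or.inl (ha.trans (H.mul_eq_zero ha).symm)))
    have hc : c ≠ 0 := fun hc => ha (H.symm.mul_eq_zero hc)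
    rcases lt_trichotomy ‖a‖ 1 with h | h | h
    · exact Or.inl ⟨⟨norm_pos_iff.2 ha, h⟩, norm_pos_iff.2 hc, H.norm_lt_one h⟩
    · rcases H.eq_or_eq_inv_of_norm_eq_one h hc with rfl | rfl
      · simp
      · rw [inv_eq_conj h]
        simp
    · exact Or.inr (Or.inl ⟨h, H.one_lt_norm h⟩)
  · rintro (⟨⟨ha0, ha1⟩, hc0, hc1⟩ | ⟨ha, hc⟩ | rfl | rfl)
    · exact topologicallyConjugate_mul_of_norm_lt_one ha0 ha1 hc0 hc1
    · have ha0 := one_pos.trans ha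
      have hc0 := one_pos.trans hc
      have := (topologicallyConjugate_mul_of_norm_lt_one (a := a⁻¹) (c := c⁻¹)
        (by simpa using ha0) (by rw [norm_inv]; exact inv_lt_one_of_one_lt₀ ha)
        (by simpa using hc0) (by rw [norm_inv]; exact inv_lt_one_of_one_lt₀ hc)).mul_inv
        (inv_ne_zero (norm_pos_iff.1 ha0)) (inv_ne_zero (norm_pos_iff.1 hc0))
      simpa only [inv_inv] using this
    · exact topologicallyConjugate_mul_iff.2 ⟨Homeomorph.refl ℂ, fun _ => rfl⟩
    · exact topologicallyConjugate_mul_iff.2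
        ⟨conjCLE.toHomeomorph, fun z => by simp⟩
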